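/- **Model.** A (static) pinball machine is a finite list of components in the plane: plane walls and one-way gates (segments with rational end points), and parabolic walls $y=ax^2+bx+c$, $x_0\le x\le x_1$, with rational $a,b,c,x_0,x_1$. A point-like ball moves in straight lines with constant velocity and is reflected, by the law of reflection with respect to the tangent, at every wall or parabola it meets; a one-way gate lets it pass unchanged if it moves in the direction in which the gate opens (the direction from start to end point turned clockwise by $90^\circ$) and acts as a wall otherwise. The motion is not continued after a tangential hit or a hit at a point where two components obstruct the ball. **Lemma (space offset stack).** (a) Focus property. Let $a>0$, $b$, $x_0,x_1$ be rational and let the parabolic wall $y=ax^2+b$, $x_0\le x\le x_1$, be the only component. A ball that starts at $(\ell,h)$ with $x_0\le\ell\le x_1$ and $h>a\ell^2+b$, moving vertically downwards with speed $\sigma>0$, is at the focus $(0,\frac1{4a}+b)$ after time $\bigl(h-b+\frac1{4a}\bigr)/\sigma$, which does not depend on $\ell$. (b) Stack gadgets. There are rational numbers $w$, $H$, $e_0$, $e_1$ with $e_0+1<e_1$, real numbers $L,L'$, and static pinball machines $\mathrm{push}_0,\mathrm{push}_1,\mathrm{pop},\mathrm{rejoin}$, consisting of plane walls, one-way gates and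 parabolic walls inside the rectangle $[-w,w]\times[0,H]$, strictly between the starting line $y=H$ and the finishing line $y=0$, with the following properties. Say that a machine delivers $x$ to $x'$ with length $L$ if, for every speed $\sigma>0$, a ball that crosses the starting line at $x$ vertically downwards with speed $\sigma$ stays in the rectangle and after time $L/\sigma$ crosses the finishing line at $x'$ vertically downwards with speed $\sigma$. 1. For $b\in\{0,1\}$ and every offset $s\in(0,1)$, $\mathrm{push}_b$ delivers $s$ to $\frac{s+b}2$ with length $L$. 2. For every offset $s\in(0,1)$ with $s\ne\frac12$, with $b=\lfloor 2s\rfloor$ the popped bit, $\mathrm{pop}$ delivers $s$ to $e_b+(2s-\lfloor 2s\rfloor)$ with length $L$; so the popped bit selects one of two disjoint output intervals, the left one for $0$ and the right one for $1$. 3. For $b\in\{0,1\}$ and every $s\in(0,1)$, $\mathrm{rejoin}$ delivers $e_b+s$ to $s$ with length $L'$. 4. Represent a stack with bits $b_1,\dots,b_k$ (top first) by the offset $\langle b_1\dots b_k\rangle=0.b_1b_2\dots b_k11$ in binary, the final $11$ being a bottom symbol. Every such offset lies in $(0,1)\setminus\{\frac12\}$, $\mathrm{push}_b$ delivers $\langle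 u\rangle$ to $\langle bu\rangle$, and $\mathrm{pop}$ delivers $\langle bu\rangle$ to $e_b+\langle u\rangle$, for every bit $b$ and every finite bit string $u$, all with length $L$. In particular the travel time is independent of the offset and is the same for $\mathrm{push}_0$, $\mathrm{push}_1$ and $\mathrm{pop}$. -/

import Mathlib

/-- A static component of a pinball machine: a plane wall or a one-way gate, given by its rational
start and end points, or a parabolic wall `y = a x² + b x + c`, `x₀ ≤ x ≤ x₁`, with rational data. -/
inductive PinballComponent : Type where
  | wall (P Q : ℚ × ℚ)
  | gate (P Q : ℚ × ℚ)
  | parabola (a b c x₀ x₁ : ℚ)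

namespace PinballComponent

/-- The set of points of the plane occupied by a component. -/
def carrier : PinballComponent → Set (ℝ × ℝ)
  | wall P Q => segment ℝ ((P.1 : ℝ), (P.2 : ℝ)) ((Q.1 : ℝ), (Q.2 : ℝ))
  | gate P Q => segment ℝ ((P.1 : ℝ), (P.2 : ℝ)) ((Q.1 : ℝ), (Q.2 : ℝ))
  | parabola a b c x₀ x₁ =>
      {p | (x₀ : ℝ) ≤ p.1 ∧ p.1 ≤ (x₁ : ℝ) ∧ p.2 = (a : ℝ) * p.1 ^ 2 + (b : ℝ) * p.1 + (c : ℝ)}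

/-- A normal vector at a point of a component. For walls and gates it is the vector from start to
end, turned clockwise by 90 degrees; for a parabola it is orthogonal to the tangent. -/
def normal : PinballComponent → ℝ × ℝ → ℝ × ℝ
  | wall P Q, _ => ((Q.2 : ℝ) - (P.2 : ℝ), (P.1 : ℝ) - (Q.1 : ℝ))
  | gate P Q, _ => ((Q.2 : ℝ) - (P.2 : ℝ), (P.1 : ℝ) - (Q.1 : ℝ))
  | parabola a b _ _ _, p => (2 * (a : ℝ) * p.1 + (b : ℝ), -1)

end PinballComponent

/-- The standard scalar product of the plane. -/
def planeDot (u v : ℝ × ℝ) : ℝ := u.1 * v.1 + u.2 * v.2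

/-- Law of reflection: the velocity `v` reflected in the line orthogonal to `n`. -/
noncomputable def reflectVelocity (n v : ℝ × ℝ) : ℝ × ℝ :=
  v - (2 * planeDot v n / planeDot n n) • n

/-- The component `K` obstructs a ball that is at the point `p` with velocity `v`. Walls and
parabolas always do; a gate lets the ball through exactly if the ball moves in the direction in
which the gate opens (the clockwise normal direction of the gate). -/
def PinballComponent.Obstructs (K : PinballComponent) (p v : ℝ × ℝ) : Prop :=
  p ∈ K.carrier ∧
    match K with
    | .gate _ _ => ¬ 0 < planeDot v (K.normal p)
    | _ => True

/-- `Travels M R p v t p' v'`: in the machine with components `M`, the (point-like) ball that is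
at `p` with velocity `v` at time `0` is at `p'` with velocity `v'` at time `t ≥ 0`, and its path
between these times stays in the region `R`. The ball moves along straight lines at constant
velocity until it first meets an obstructing component, where it is reflected. The motion is not
continued through a point where two different components obstruct the ball, or where the ball
meets a component tangentially. -/
inductive Travels (M : List PinballComponent) (R : Set (ℝ × ℝ)) :
    ℝ × ℝ → ℝ × ℝ → ℝ → ℝ × ℝ → ℝ × ℝ → Prop where
  | fly (p v : ℝ × ℝ) (τ : ℝ) (hτ : 0 ≤ τ)
      (hR : ∀ t, 0 ≤ t → t ≤ τ → p + t • v ∈ R)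
      (hfree : ∀ t, 0 < t → t ≤ τ → ∀ K ∈ M, ¬ K.Obstructs (p + t • v) v) :
      Travels M R p v τ (p + τ • v) v
  | bounce (p v : ℝ × ℝ) (τ : ℝ) (K : PinballComponent) (t' : ℝ) (p' v' : ℝ × ℝ) (hτ : 0 < τ)
      (hR : ∀ t, 0 ≤ t → t ≤ τ → p + t • v ∈ R)
      (hfree : ∀ t, 0 < t → t < τ → ∀ K' ∈ M, ¬ K'.Obstructs (p + t • v) v)
      (hK : K ∈ M)
      (hhit : K.Obstructs (p + τ • v) v)
      (honly : ∀ K' ∈ M, K'.Obstructs (p + τ • v) v → K' = K)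
      (htransversal : planeDot v (K.normal (p + τ • v)) ≠ 0)
      (hrest : Travels M R (p + τ • v) (reflectVelocity (K.normal (p + τ • v)) v) t' p' v') :
      Travels M R p v (τ + t') p' v'

/-- The rectangle `[-w, w] × [0, H]`: its upper side lies on the starting line `y = H`, its lower
side on the finishing line `y = 0`. -/
def gadgetBox (w H : ℚ) : Set (ℝ × ℝ) :=
  Set.Icc (-(w : ℝ)) (w : ℝ) ×ˢ Set.Icc (0 : ℝ) (H : ℝ)

/-- All components lie in the rectangle, strictly below the starting line and strictly above the
finishing line. -/
def FitsBox (w H : ℚ) (M : List PinballComponent) : Prop :=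
  ∀ K ∈ M, ∀ p ∈ K.carrier, -(w : ℝ) ≤ p.1 ∧ p.1 ≤ (w : ℝ) ∧ 0 < p.2 ∧ p.2 < (H : ℝ)

/-- Whatever its speed `σ`, a ball that crosses the starting line vertically downwards at `x = x₁`
stays in the rectangle and, after travelling the length `L`, that is, after the time `L / σ`,
crosses the finishing line vertically downwards at `x = x₂`, with its speed unchanged. -/
def Delivers (w H : ℚ) (M : List PinballComponent) (x₁ x₂ L : ℝ) : Prop :=
  ∀ σ : ℝ, 0 < σ →
    Travels M (gadgetBox w H) (x₁, (H : ℝ)) (0, -σ) (L / σ) (x₂, 0) (0, -σ)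

/-- A bit as a real number. -/
def bitVal (b : Bool) : ℝ := if b then 1 else 0

/-- The offset that represents a stack of bits (top first): the binary fraction
`0.b₁b₂…bₖ11`, where the final digits `11` are the bottom symbol. -/
noncomputable def stackOffset : List Bool → ℝ
  | [] => 3 / 4
  | b :: l => (stackOffset l + bitVal b) / 2

/-!
A ray falling parallel to the axis of a parabola is reflected along the line through its focus.
If two parabolas with vertical axes have the same focus, the homothety centred at the focus that
carries one to the other maps each point to a point with a parallel tangent. Hence a ball that
falls onto the first parabola at horizontal distance `ℓ` from the focus, and meets the second one
at the homothetic point at distance `λℓ`, falls vertically again: the pair acts as a telescope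
`c + ℓ ↦ c + λℓ`, where `c` is the abscissa of the focus. By the definition of a parabola through
focus and directrix, the total length of the path does not depend on `ℓ`; with `y = a x² + …` as
the first parabola it exceeds the height of fall by `(1 - λ) / (2a)`.

With `λ = 1/2` and the focus on the line `x = -1`, followed by a translation by `1/2` with the help
of two parallel diagonal walls, this gives the push of a `0`: `pushZero_unitDelivers`. With `λ = 2`
the ball is reflected away from the focus at the convex side of the first parabola, and two such
telescopes over the two halves of the unit interval give pop: `popGadget_unitDelivers`. The
curvatures are chosen such that both lengths are `7`. Two pairs of parallel diagonal walls, one of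
the walls replaced by a gate that falling balls pass, bring the two exit intervals back together:
`rejoinGadget_unitDelivers_left` and `rejoinGadget_unitDelivers_right`.

Two invariances reduce the work. The path of the ball does not depend on its speed
(`Travels.scale_speed`), so that unit speed suffices; and motions can be reflected in the line
`x = 1/2` (`Travels.mirror`), which exchanges the offsets `s` and `1 - s` and with them the two push
gadgets and the two halves of pop.
-/

/-! ### Moving along chords -/

theorem point_mem_openSegment {p q v : ℝ × ℝ} {τ t : ℝ} (hq : p + τ • v = q) (h0 : 0 < t)
    (h1 : t < τ) : p + t • v ∈ openSegment ℝ p q := by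
  have hτ : 0 < τ := h0.trans h1
  refine ⟨1 - t / τ, t / τ, sub_pos.2 ((div_lt_one hτ).2 h1), by positivity, by ring, ?_⟩
  rw [← hq]
  ext <;> simp <;> field_simp <;> ring

theorem point_mem_of_convex {R : Set (ℝ × ℝ)} (hR : Convex ℝ R) {p q v : ℝ × ℝ} {τ t : ℝ}
    (hp : p ∈ R) (hqR : q ∈ R) (hq : p + τ • v = q) (h0 : 0 ≤ t) (h1 : t ≤ τ) :
    p + t • v ∈ R := by
  rcases h0.eq_or_lt with rfl | h0
  · simpa using hp
  rcases h1.eq_or_lt with rfl | h1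
  · rwa [hq]
  · exact hR.openSegment_subset hp hqR (point_mem_openSegment hq h0 h1)

/-- Free flight to `q`, with the conditions on the path stated for the points of the chord. -/
theorem Travels.fly_to {M : List PinballComponent} {R : Set (ℝ × ℝ)} {p q v : ℝ × ℝ} {τ : ℝ}
    (hR : Convex ℝ R) (hp : p ∈ R) (hqR : q ∈ R) (hτ : 0 ≤ τ) (hq : p + τ • v = q)
    (hfree : ∀ z ∈ openSegment ℝ p q, ∀ K ∈ M, ¬ K.Obstructs z v)
    (hend : ∀ K ∈ M, ¬ K.Obstructs q v) : Travels M R p v τ q v := by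
  have h := Travels.fly (M := M) (R := R) p v τ hτ
    (fun t h0 h1 => point_mem_of_convex hR hp hqR hq h0 h1) (fun t h0 h1 => by
      rcases h1.eq_or_lt with rfl | h1
      · rwa [hq]
      · exact hfree _ (point_mem_openSegment hq h0 h1))
  rwa [hq] at h

/-- A flight to the point `q` of the component `K`, followed by a reflection, with the conditions
on the path stated for the points of the chord. -/
theorem Travels.bounce_to {M : List PinballComponent} {R : Set (ℝ × ℝ)}
    {q v₁ : ℝ × ℝ} {τ t' : ℝ} (K : PinballComponent) {p v p' v' : ℝ × ℝ} {t : ℝ}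
    (hR : Convex ℝ R) (hp : p ∈ R) (hqR : q ∈ R) (hτ : 0 < τ) (hq : p + τ • v = q)
    (hfree : ∀ z ∈ openSegment ℝ p q, ∀ K ∈ M, ¬ K.Obstructs z v)
    (hK : K ∈ M) (hhit : K.Obstructs q v)
    (honly : ∀ K' ∈ M, K' = K ∨ ¬ K'.Obstructs q v)
    (htransversal : planeDot v (K.normal q) ≠ 0)
    (hv : reflectVelocity (K.normal q) v = v₁)
    (hrest : Travels M R q v₁ t' p' v') (ht : t = τ + t') : Travels M R p v t p' v' := by
  subst ht hq hv
  exact Travels.bounce p v τ K t' p' v' hτ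
    (fun t h0 h1 => point_mem_of_convex hR hp hqR rfl h0 h1)
    (fun t h0 h1 => hfree _ (point_mem_openSegment rfl h0 h1)) hK hhit
    (fun K' h h' => (honly K' h).resolve_right (not_not_intro h')) htransversal hrest

theorem mem_openSegment_vertical {x y y' : ℝ} (h : y' < y) {z : ℝ × ℝ}
    (hz : z ∈ openSegment ℝ (x, y) (x, y')) : z.1 = x ∧ y' < z.2 ∧ z.2 < y := by
  obtain ⟨c, d, hc, hd, hcd, rfl⟩ := hz
  obtain rfl : c = 1 - d := by linarith
  simp
  refine ⟨by ring, by nlinarith, by nlinarith⟩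

theorem mem_openSegment_right {x x' y : ℝ} (h : x < x') {z : ℝ × ℝ}
    (hz : z ∈ openSegment ℝ (x, y) (x', y)) : z.2 = y ∧ x < z.1 ∧ z.1 < x' := by
  obtain ⟨c, d, hc, hd, hcd, rfl⟩ := hz
  obtain rfl : c = 1 - d := by linarith
  simp
  refine ⟨by ring, by nlinarith, by nlinarith⟩

theorem mem_openSegment_left {x x' y : ℝ} (h : x' < x) {z : ℝ × ℝ}
    (hz : z ∈ openSegment ℝ (x, y) (x', y)) : z.2 = y ∧ x' < z.1 ∧ z.1 < x :=
  mem_openSegment_right h (openSegment_symm ℝ (x, y) (x', y) ▸ hz)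

/-! ### Invariances of the motion -/

theorem Travels.mono {M M' : List PinballComponent} {R R' : Set (ℝ × ℝ)}
    (hM : ∀ K, K ∈ M ↔ K ∈ M') (hR : R ⊆ R') {p v p' v' : ℝ × ℝ} {t : ℝ}
    (h : Travels M R p v t p' v') : Travels M' R' p v t p' v' := by
  induction h with
  | fly p v τ hτ hr hfree =>
    exact .fly p v τ hτ (fun t h0 h1 => hR (hr t h0 h1))
      (fun t h0 h1 K hK => hfree t h0 h1 K ((hM K).2 hK))
  | bounce p v τ K t' p' v' hτ hr hfree hK hhit honly htr _ ih =>
    exact .bounce p v τ K t' p' v' hτ (fun t h0 h1 => hR (hr t h0 h1))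
      (fun t h0 h1 K hK => hfree t h0 h1 K ((hM K).2 hK)) ((hM K).1 hK) hhit
      (fun K' h => honly K' ((hM K').2 h)) htr ih

theorem planeDot_smul_left (c : ℝ) (u v : ℝ × ℝ) : planeDot (c • u) v = c * planeDot u v := by
  simp [planeDot]; ring

theorem reflectVelocity_smul (c : ℝ) (n v : ℝ × ℝ) :
    reflectVelocity n (c • v) = c • reflectVelocity n v := by
  unfold reflectVelocity
  rw [planeDot_smul_left, smul_sub, smul_smul]
  congr 2
  ring

theorem PinballComponent.obstructs_smul {K : PinballComponent} {p v : ℝ × ℝ} {c : ℝ} (hc : 0 < c) :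
    K.Obstructs p (c • v) ↔ K.Obstructs p v := by
  cases K <;> simp [Obstructs, planeDot_smul_left, hc]

/-- The path of the ball does not depend on its speed; the travel time is inversely proportional
to it. -/
theorem Travels.scale_speed {M : List PinballComponent} {R : Set (ℝ × ℝ)} {p v p' v' : ℝ × ℝ}
    {t σ : ℝ} (hσ : 0 < σ) (h : Travels M R p v t p' v') :
    Travels M R p (σ • v) (t / σ) p' (σ • v') := by
  have key : ∀ (p v : ℝ × ℝ) (t : ℝ), p + t • σ • v = p + (t * σ) • v := fun p v t => by
    rw [smul_smul]
  have key' : ∀ (p v : ℝ × ℝ) (t : ℝ), p + (t / σ) • σ • v = p + t • v := fun p v t => by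
    rw [key, div_mul_cancel₀ _ hσ.ne']
  induction h with
  | fly p v τ hτ hr hfree =>
    rw [← key']
    refine .fly p _ _ (by positivity) (fun t h0 h1 => ?_) (fun t h0 h1 K hK => ?_)
    · rw [key]
      exact hr _ (by positivity) ((le_div_iff₀ hσ).1 h1)
    · rw [key, PinballComponent.obstructs_smul hσ]
      exact hfree _ (by positivity) ((le_div_iff₀ hσ).1 h1) K hK
  | bounce p v τ K t' p' v' hτ hr hfree hK hhit honly htr _ ih =>
    rw [add_div]
    refine .bounce p _ _ K _ _ _ (by positivity) (fun t h0 h1 => ?_) (fun t h0 h1 K hK => ?_) hK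
      ?_ ?_ ?_ ?_
    · rw [key]
      exact hr _ (by positivity) ((le_div_iff₀ hσ).1 h1)
    · rw [key, PinballComponent.obstructs_smul hσ]
      exact hfree _ (by positivity) ((lt_div_iff₀ hσ).1 h1) K hK
    · rwa [key', PinballComponent.obstructs_smul hσ]
    · intro K' h
      rw [key', PinballComponent.obstructs_smul hσ]
      exact honly K' h
    · rw [key', planeDot_smul_left]
      exact mul_ne_zero hσ.ne' htr
    · rwa [key', reflectVelocity_smul]

/-- The reflection of the plane in the line `x = 1 / 2`, which exchanges the offsets `s` and
`1 - s`. -/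
def mirrorPoint (p : ℝ × ℝ) : ℝ × ℝ := (1 - p.1, p.2)

/-- The linear part of `mirrorPoint`. -/
def mirrorVector (v : ℝ × ℝ) : ℝ × ℝ := (-v.1, v.2)

/-- The mirror image of a component in the line `x = 1 / 2`. The ends of a gate are exchanged, so
that the image of the gate opens in the image of the direction in which the gate opens. -/
def PinballComponent.mirror : PinballComponent → PinballComponent
  | wall P Q => wall (1 - Q.1, Q.2) (1 - P.1, P.2)
  | gate P Q => gate (1 - Q.1, Q.2) (1 - P.1, P.2)
  | parabola a b c x₀ x₁ => parabola a (-(2 * a + b)) (a + b + c) (1 - x₁) (1 - x₀)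

theorem PinballComponent.mirror_mirror (K : PinballComponent) : K.mirror.mirror = K := by
  cases K <;> simp [mirror]; ring

theorem mirrorPoint_mirrorPoint (p : ℝ × ℝ) : mirrorPoint (mirrorPoint p) = p := by
  simp [mirrorPoint]

theorem mirrorPoint_add_smul (p v : ℝ × ℝ) (t : ℝ) :
    mirrorPoint p + t • mirrorVector v = mirrorPoint (p + t • v) := by
  ext <;> simp [mirrorPoint, mirrorVector]; ring

theorem planeDot_mirrorVector (u v : ℝ × ℝ) :
    planeDot (mirrorVector u) (mirrorVector v) = planeDot u v := by
  simp [planeDot, mirrorVector]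

theorem reflectVelocity_mirrorVector (n v : ℝ × ℝ) :
    reflectVelocity (mirrorVector n) (mirrorVector v) = mirrorVector (reflectVelocity n v) := by
  unfold reflectVelocity
  rw [planeDot_mirrorVector, planeDot_mirrorVector]
  ext <;> simp [mirrorVector]; ring

theorem PinballComponent.normal_mirror (K : PinballComponent) (p : ℝ × ℝ) :
    K.mirror.normal (mirrorPoint p) = mirrorVector (K.normal p) := by
  cases K <;> simp [mirror, normal, mirrorPoint, mirrorVector]
  ring

theorem mirrorPoint_mem_segment {p q z : ℝ × ℝ} (h : z ∈ segment ℝ p q) :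
    mirrorPoint z ∈ segment ℝ (mirrorPoint q) (mirrorPoint p) := by
  obtain ⟨c, d, hc, hd, hcd, rfl⟩ := h
  refine ⟨d, c, hd, hc, by linarith, ?_⟩
  obtain rfl : c = 1 - d := by linarith
  ext <;> simp [mirrorPoint] <;> ring

theorem PinballComponent.mirrorPoint_mem_carrier {K : PinballComponent} {p : ℝ × ℝ}
    (h : p ∈ K.carrier) : mirrorPoint p ∈ K.mirror.carrier := by
  cases K with
  | wall P Q => simpa [mirror, carrier, mirrorPoint] using mirrorPoint_mem_segment h
  | gate P Q => simpa [mirror, carrier, mirrorPoint] using mirrorPoint_mem_segment h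
  | parabola a b c x₀ x₁ =>
    obtain ⟨h0, h1, h2⟩ := h
    refine ⟨by simp only [mirrorPoint]; push_cast; linarith,
      by simp only [mirrorPoint]; push_cast; linarith, ?_⟩
    simp [mirrorPoint, h2]
    ring

theorem PinballComponent.mirrorPoint_mem_carrier_iff {K : PinballComponent} {p : ℝ × ℝ} :
    mirrorPoint p ∈ K.mirror.carrier ↔ p ∈ K.carrier :=
  ⟨fun h => by simpa [mirror_mirror, mirrorPoint_mirrorPoint] using mirrorPoint_mem_carrier h,
    mirrorPoint_mem_carrier⟩

theorem PinballComponent.obstructs_mirror {K : PinballComponent} {p v : ℝ × ℝ} :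
    K.mirror.Obstructs (mirrorPoint p) (mirrorVector v) ↔ K.Obstructs p v := by
  unfold Obstructs
  rw [mirrorPoint_mem_carrier_iff]
  cases K with
  | wall P Q => rfl
  | parabola a b c x₀ x₁ => rfl
  | gate P Q =>
    have h := normal_mirror (gate P Q) p
    simp only [mirror] at h ⊢
    rw [h, planeDot_mirrorVector]

/-- The mirror image of a motion is a motion in the mirror image of the machine. -/
theorem Travels.mirror {M : List PinballComponent} {R : Set (ℝ × ℝ)}
    (hR : ∀ z ∈ R, mirrorPoint z ∈ R) {p v p' v' : ℝ × ℝ} {t : ℝ} (h : Travels M R p v t p' v') :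
    Travels (M.map PinballComponent.mirror) R (mirrorPoint p) (mirrorVector v) t
      (mirrorPoint p') (mirrorVector v') := by
  induction h with
  | fly p v τ hτ hr hfree =>
    rw [← mirrorPoint_add_smul]
    refine .fly _ _ _ hτ (fun t h0 h1 => ?_) (fun t h0 h1 => List.forall_mem_map.2 fun K hK => ?_)
    · rw [mirrorPoint_add_smul]
      exact hR _ (hr t h0 h1)
    · rw [mirrorPoint_add_smul, PinballComponent.obstructs_mirror]
      exact hfree t h0 h1 K hK
  | bounce p v τ K t' p' v' hτ hr hfree hK hhit honly htr _ ih =>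
    refine .bounce _ _ _ K.mirror _ _ _ hτ (fun t h0 h1 => ?_)
      (fun t h0 h1 => List.forall_mem_map.2 fun K hK => ?_) (List.mem_map_of_mem hK) ?_
      (List.forall_mem_map.2 fun K' h => ?_) ?_ ?_
    · rw [mirrorPoint_add_smul]
      exact hR _ (hr t h0 h1)
    · rw [mirrorPoint_add_smul, PinballComponent.obstructs_mirror]
      exact hfree t h0 h1 K hK
    · rwa [mirrorPoint_add_smul, PinballComponent.obstructs_mirror]
    · rw [mirrorPoint_add_smul, PinballComponent.obstructs_mirror]
      exact fun h' => congrArg _ (honly K' h h')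
    · rwa [mirrorPoint_add_smul, PinballComponent.normal_mirror, planeDot_mirrorVector]
    · rwa [mirrorPoint_add_smul, PinballComponent.normal_mirror, reflectVelocity_mirrorVector]

/-! ### Components by equations -/

theorem mem_segment_iff_of_fst_lt {p q z : ℝ × ℝ} (h : p.1 < q.1) :
    z ∈ segment ℝ p q ↔
      p.1 ≤ z.1 ∧ z.1 ≤ q.1 ∧ (z.2 - p.2) * (q.1 - p.1) = (z.1 - p.1) * (q.2 - p.2) := by
  constructor
  · rintro ⟨c, d, hc, hd, hcd, rfl⟩
    obtain rfl : c = 1 - d := by linarith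
    simp
    refine ⟨by nlinarith, by nlinarith, by ring⟩
  · rintro ⟨h0, h1, h2⟩
    have h' : 0 < q.1 - p.1 := sub_pos.2 h
    refine ⟨(q.1 - z.1) / (q.1 - p.1), (z.1 - p.1) / (q.1 - p.1),
      div_nonneg (sub_nonneg.2 h1) h'.le, div_nonneg (sub_nonneg.2 h0) h'.le, ?_, ?_⟩
    · field_simp; ring
    · ext
      · simp; field_simp; ring
      · simp; field_simp; linarith

theorem PinballComponent.mem_wall_iff {P Q : ℚ × ℚ} (h : P.1 < Q.1) {z : ℝ × ℝ} :
    z ∈ (wall P Q).carrier ↔ (P.1 : ℝ) ≤ z.1 ∧ z.1 ≤ (Q.1 : ℝ) ∧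
      (z.2 - P.2) * ((Q.1 : ℝ) - P.1) = (z.1 - P.1) * ((Q.2 : ℝ) - P.2) :=
  mem_segment_iff_of_fst_lt (Rat.cast_lt.2 h)

theorem PinballComponent.mem_gate_iff {P Q : ℚ × ℚ} (h : P.1 < Q.1) {z : ℝ × ℝ} :
    z ∈ (gate P Q).carrier ↔ (P.1 : ℝ) ≤ z.1 ∧ z.1 ≤ (Q.1 : ℝ) ∧
      (z.2 - P.2) * ((Q.1 : ℝ) - P.1) = (z.1 - P.1) * ((Q.2 : ℝ) - P.2) :=
  mem_segment_iff_of_fst_lt (Rat.cast_lt.2 h)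

theorem PinballComponent.mem_parabola_iff {a b c x₀ x₁ : ℚ} {z : ℝ × ℝ} :
    z ∈ (parabola a b c x₀ x₁).carrier ↔
      (x₀ : ℝ) ≤ z.1 ∧ z.1 ≤ (x₁ : ℝ) ∧ z.2 = (a : ℝ) * z.1 ^ 2 + (b : ℝ) * z.1 + (c : ℝ) :=
  Iff.rfl

theorem PinballComponent.wall_obstructs_iff {P Q : ℚ × ℚ} (h : P.1 < Q.1) {z v : ℝ × ℝ} :
    (wall P Q).Obstructs z v ↔ (P.1 : ℝ) ≤ z.1 ∧ z.1 ≤ (Q.1 : ℝ) ∧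
      (z.2 - P.2) * ((Q.1 : ℝ) - P.1) = (z.1 - P.1) * ((Q.2 : ℝ) - P.2) :=
  (iff_of_eq (and_true _)).trans (mem_wall_iff h)

theorem PinballComponent.gate_obstructs_iff {P Q : ℚ × ℚ} (h : P.1 < Q.1) {z v : ℝ × ℝ} :
    (gate P Q).Obstructs z v ↔ ((P.1 : ℝ) ≤ z.1 ∧ z.1 ≤ (Q.1 : ℝ) ∧
      (z.2 - P.2) * ((Q.1 : ℝ) - P.1) = (z.1 - P.1) * ((Q.2 : ℝ) - P.2)) ∧
      v.1 * ((Q.2 : ℝ) - P.2) + v.2 * ((P.1 : ℝ) - Q.1) ≤ 0 :=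
  and_congr (mem_gate_iff h) not_lt

theorem PinballComponent.parabola_obstructs_iff {a b c x₀ x₁ : ℚ} {z v : ℝ × ℝ} :
    (parabola a b c x₀ x₁).Obstructs z v ↔
      (x₀ : ℝ) ≤ z.1 ∧ z.1 ≤ (x₁ : ℝ) ∧ z.2 = (a : ℝ) * z.1 ^ 2 + (b : ℝ) * z.1 + (c : ℝ) :=
  (iff_of_eq (and_true _)).trans mem_parabola_iff

/-! ### Reflection at parabolas and at diagonal walls -/

/-- `m` is the slope of the tangent, so that `(m, -1)` is the normal of the parabolic wall. -/
theorem reflectVelocity_down (m : ℝ) :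
    reflectVelocity (m, -1) (0, -1) = (-2 * m / (1 + m ^ 2), (1 - m ^ 2) / (1 + m ^ 2)) := by
  have : 1 + m ^ 2 ≠ 0 := by positivity
  have h : m * m + 1 ≠ 0 := by nlinarith
  ext <;> simp [reflectVelocity, planeDot] <;> field_simp <;> ring

theorem reflectVelocity_to_down (m : ℝ) :
    reflectVelocity (m, -1) (-2 * m / (1 + m ^ 2), (1 - m ^ 2) / (1 + m ^ 2)) = (0, -1) := by
  have : 1 + m ^ 2 ≠ 0 := by positivity
  have h : m * m + 1 ≠ 0 := by nlinarith
  ext <;> simp [reflectVelocity, planeDot] <;> field_simp <;> ring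

theorem planeDot_of_reflectVelocity_down_ne_zero (m : ℝ) :
    planeDot (-2 * m / (1 + m ^ 2), (1 - m ^ 2) / (1 + m ^ 2)) (m, -1) ≠ 0 := by
  have : 1 + m ^ 2 ≠ 0 := by positivity
  have h : planeDot (-2 * m / (1 + m ^ 2), (1 - m ^ 2) / (1 + m ^ 2)) (m, -1) = -1 := by
    simp [planeDot]; field_simp; ring
  rw [h]; norm_num

/-! ### The focus of a parabolic wall -/

/-- The distance from the point of impact to the focus, `a * ℓ ^ 2 + 1 / (4 * a)`, makes up for the
different heights of fall. -/
theorem travels_to_focus {a b x₀ x₁ : ℚ} {ℓ h : ℝ} (ha : 0 < a) (h0 : (x₀ : ℝ) ≤ ℓ)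
    (h1 : ℓ ≤ (x₁ : ℝ)) (hh : (a : ℝ) * ℓ ^ 2 + (b : ℝ) < h) :
    ∃ v : ℝ × ℝ, Travels [PinballComponent.parabola a 0 b x₀ x₁] Set.univ (ℓ, h) (0, -1)
      (h - (b : ℝ) + 1 / (4 * (a : ℝ))) (0, 1 / (4 * (a : ℝ)) + (b : ℝ)) v := by
  have ha' : (0 : ℝ) < a := Rat.cast_pos.2 ha
  have hN : 1 + (2 * (a : ℝ) * ℓ) ^ 2 ≠ 0 := by positivity
  refine ⟨_, Travels.bounce_to (.parabola a 0 b x₀ x₁) (q := (ℓ, (a : ℝ) * ℓ ^ 2 + b))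
    (τ := h - ((a : ℝ) * ℓ ^ 2 + b)) (t' := (1 + (2 * (a : ℝ) * ℓ) ^ 2) / (4 * a)) convex_univ
    trivial trivial (sub_pos.2 hh) ?_ ?_ ?_ ?_ ?_ ?_ ?_ (Travels.fly_to
      (v := (-2 * (2 * a * ℓ) / (1 + (2 * a * ℓ) ^ 2),
        (1 - (2 * a * ℓ) ^ 2) / (1 + (2 * a * ℓ) ^ 2)))
      convex_univ trivial trivial ?_ ?_ ?_ ?_) ?_⟩
  · ext <;> simp
  · intro z hz
    obtain ⟨e0, e1, e2⟩ := mem_openSegment_vertical hh hz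
    simp only [List.mem_singleton, forall_eq, PinballComponent.parabola_obstructs_iff, e0]
    push_cast
    rintro ⟨-, -, e⟩
    linarith
  · simp
  · rw [PinballComponent.parabola_obstructs_iff]
    exact ⟨h0, h1, by simp⟩
  · simp
  · simp [planeDot, PinballComponent.normal]
  · simpa [PinballComponent.normal] using reflectVelocity_down (2 * a * ℓ)
  · positivity
  · ext <;> simp <;> field_simp <;> ring
  · rintro z ⟨c, d, hc, hd, hcd, rfl⟩
    obtain rfl : d = 1 - c := by linarith
    simp only [List.mem_singleton, forall_eq, PinballComponent.parabola_obstructs_iff]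
    rintro ⟨-, -, e⟩
    -- at the point `c • p + (1 - c) • q` of the chord from `p` to `q` the ball is above the parabola
    have : (1 - c) * (c * (a * ℓ ^ 2) + 1 / (4 * a)) = 0 := by
      simp at e
      field_simp at e ⊢
      linarith
    have : 0 < (1 - c) * (c * (a * ℓ ^ 2) + 1 / (4 * a)) := by positivity
    linarith
  · simp only [List.mem_singleton, forall_eq, PinballComponent.parabola_obstructs_iff]
    rintro ⟨-, -, e⟩
    have : 1 / (4 * (a : ℝ)) = 0 := by simpa using e
    have : 0 < 1 / (4 * (a : ℝ)) := by positivity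
    linarith
  · field_simp; ring

/-! ### Machines between two vertical lines -/

/-- The rectangle `[-1, 2] × [0, 6]`, which contains the paths in all gadgets and is its own
mirror image. -/
def pathBox : Set (ℝ × ℝ) := Set.Icc (-1) 2 ×ˢ Set.Icc 0 6

theorem convex_pathBox : Convex ℝ pathBox := (convex_Icc _ _).prod (convex_Icc _ _)

theorem mirrorPoint_mem_pathBox {z : ℝ × ℝ} (h : z ∈ pathBox) : mirrorPoint z ∈ pathBox := by
  obtain ⟨⟨h0, h1⟩, h2⟩ := h
  exact ⟨⟨by simp only [mirrorPoint]; linarith, by simp only [mirrorPoint]; linarith⟩, h2⟩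

theorem mk_mem_pathBox {x y : ℝ} (h0 : -1 ≤ x) (h1 : x ≤ 2) (h2 : 0 ≤ y) (h3 : y ≤ 6) :
    (x, y) ∈ pathBox := ⟨⟨h0, h1⟩, h2, h3⟩

theorem pathBox_subset : pathBox ⊆ gadgetBox 2 6 := by
  rintro z ⟨⟨h0, h1⟩, h2, h3⟩
  refine ⟨⟨?_, ?_⟩, ?_, ?_⟩ <;> push_cast <;> linarith

/-- Delivery at unit speed inside `pathBox`. -/
def UnitDelivers (M : List PinballComponent) (x x' L : ℝ) : Prop :=
  Travels M pathBox (x, 6) (0, -1) L (x', 0) (0, -1)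

theorem UnitDelivers.delivers {M : List PinballComponent} {x x' L : ℝ}
    (h : UnitDelivers M x x' L) : Delivers 2 6 M x x' L := by
  intro σ hσ
  simpa using (h.mono (fun _ => Iff.rfl) pathBox_subset).scale_speed hσ

theorem UnitDelivers.mirror {M : List PinballComponent} {x x' L : ℝ}
    (h : UnitDelivers M x x' L) :
    UnitDelivers (M.map PinballComponent.mirror) (1 - x) (1 - x') L := by
  simpa [UnitDelivers, mirrorPoint, mirrorVector] using
    Travels.mirror (fun _ => mirrorPoint_mem_pathBox) h

/-- All components lie in `[-1, 2] × (0, 6)`. -/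
def FitsPathBox (M : List PinballComponent) : Prop :=
  ∀ K ∈ M, ∀ p ∈ K.carrier, -1 ≤ p.1 ∧ p.1 ≤ 2 ∧ 0 < p.2 ∧ p.2 < 6

theorem FitsPathBox.fitsBox {M : List PinballComponent} (h : FitsPathBox M) : FitsBox 2 6 M := by
  intro K hK p hp
  obtain ⟨h0, h1, h2, h3⟩ := h K hK p hp
  refine ⟨?_, ?_, ?_, ?_⟩ <;> push_cast <;> linarith

theorem FitsPathBox.mirror {M : List PinballComponent} (h : FitsPathBox M) :
    FitsPathBox (M.map PinballComponent.mirror) := by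
  refine List.forall_mem_map.2 fun K hK p hp => ?_
  rw [← mirrorPoint_mirrorPoint p, PinballComponent.mirrorPoint_mem_carrier_iff] at hp
  obtain ⟨h0, h1, h2, h3⟩ := h K hK _ hp
  simp only [mirrorPoint] at h0 h1 h2 h3
  exact ⟨by linarith, by linarith, h2, h3⟩

theorem FitsPathBox.append {M M' : List PinballComponent} (h : FitsPathBox M)
    (h' : FitsPathBox M') : FitsPathBox (M ++ M') := by
  intro K hK
  exact (List.mem_append.1 hK).elim (h K) (h' K)

/-! ### Push -/

/-- The gadget `s ↦ s / 2`: two parabolas with common focus `(-1, 3)` halve the distance to the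
line `x = -1`, and two parallel diagonal walls move the ball to the right by `1 / 2`. -/
def pushZero : List PinballComponent :=
  [.parabola (1 / 2) 1 3 0 1, .parabola 1 2 (15 / 4) (-1 / 2) 0,
    .wall (-1 / 2, 3 / 2) (0, 1), .wall (0, 3 / 2) (1 / 2, 1)]

theorem fitsPathBox_pushZero : FitsPathBox pushZero := by
  simp only [FitsPathBox, pushZero, List.forall_mem_cons]
  refine ⟨fun p hp => ?_, fun p hp => ?_, fun p hp => ?_, fun p hp => ?_, by simp⟩
  · obtain ⟨e0, e1, e2⟩ := PinballComponent.mem_parabola_iff.1 hp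
    push_cast at e0 e1 e2
    refine ⟨?_, ?_, ?_, ?_⟩ <;> nlinarith
  · obtain ⟨e0, e1, e2⟩ := PinballComponent.mem_parabola_iff.1 hp
    push_cast at e0 e1 e2
    refine ⟨?_, ?_, ?_, ?_⟩ <;> nlinarith
  all_goals
    obtain ⟨e0, e1, e2⟩ := (PinballComponent.mem_wall_iff (by norm_num)).1 hp
    push_cast at e0 e1 e2
    refine ⟨?_, ?_, ?_, ?_⟩ <;> linarith

theorem forall_mem_pushZero_not_obstructs {z v : ℝ × ℝ}
    (h1 : 0 ≤ z.1 → z.1 ≤ 1 → z.2 ≠ z.1 ^ 2 / 2 + z.1 + 3)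
    (h2 : -1 / 2 ≤ z.1 → z.1 ≤ 0 → z.2 ≠ z.1 ^ 2 + 2 * z.1 + 15 / 4)
    (h3 : -1 / 2 ≤ z.1 → z.1 ≤ 0 → z.2 ≠ 1 - z.1)
    (h4 : 0 ≤ z.1 → z.1 ≤ 1 / 2 → z.2 ≠ 3 / 2 - z.1) :
    ∀ K ∈ pushZero, ¬ K.Obstructs z v := by
  simp only [pushZero, List.mem_cons, List.not_mem_nil, or_false, forall_eq_or_imp, forall_eq]
  rw [PinballComponent.wall_obstructs_iff (by norm_num),
    PinballComponent.wall_obstructs_iff (by norm_num),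
    PinballComponent.parabola_obstructs_iff, PinballComponent.parabola_obstructs_iff]
  push_cast
  refine ⟨?_, ?_, ?_, ?_⟩ <;> rintro ⟨e0, e1, e2⟩
  · exact h1 e0 e1 (by linarith)
  · exact h2 (by linarith) e1 (by linarith)
  · exact h3 (by linarith) e1 (by linarith)
  · exact h4 e0 e1 (by linarith)

theorem pushZero_unitDelivers {s : ℝ} (h0 : 0 < s) (h1 : s < 1) :
    UnitDelivers pushZero s (s / 2) 7 := by
  have hs : s ^ 2 < s := by nlinarith
  have hs' : 0 < s ^ 2 := by positivity
  have leg5 : Travels pushZero pathBox (s / 2, (3 - s) / 2) (0, -1) ((3 - s) / 2) (s / 2, 0)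
      (0, -1) := by
    refine .fly_to convex_pathBox (mk_mem_pathBox ?_ ?_ ?_ ?_) (mk_mem_pathBox ?_ ?_ ?_ ?_) ?_
      (by ext <;> simp) (fun z hz => ?_) ?_
    rotate_right 2
    · obtain ⟨e0, e1, e2⟩ := mem_openSegment_vertical (by linarith) hz
      refine forall_mem_pushZero_not_obstructs ?_ ?_ ?_ ?_ <;> rw [e0] <;> intro _ _ e <;> nlinarith
    · refine forall_mem_pushZero_not_obstructs ?_ ?_ ?_ ?_ <;> dsimp only <;> intro _ _ e <;>
        nlinarith
    all_goals linarith
  have leg4 : Travels pushZero pathBox ((s - 1) / 2, (3 - s) / 2) (1, 0) (1 / 2 + (3 - s) / 2)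
      (s / 2, 0) (0, -1) := by
    refine .bounce_to (.wall (0, 3 / 2) (1 / 2, 1)) (q := (s / 2, (3 - s) / 2)) convex_pathBox
      (mk_mem_pathBox ?_ ?_ ?_ ?_) (mk_mem_pathBox ?_ ?_ ?_ ?_) (by norm_num)
      (by ext <;> simp; ring) (fun z hz => ?_) (by simp [pushZero]) ?_ ?_ ?_ ?_ leg5 rfl
    rotate_right 5
    · obtain ⟨e0, e1, e2⟩ := mem_openSegment_right (by linarith) hz
      refine forall_mem_pushZero_not_obstructs ?_ ?_ ?_ ?_ <;> rw [e0] <;> intro _ _ e <;> nlinarith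
    · rw [PinballComponent.wall_obstructs_iff (by norm_num)]
      push_cast
      refine ⟨?_, ?_, ?_⟩ <;> linarith
    · simp only [pushZero, List.forall_mem_cons]
      refine ⟨.inr ?_, .inr ?_, .inr ?_, .inl trivial, by simp⟩
      rotate_right
      · rw [PinballComponent.wall_obstructs_iff (by norm_num)]
        push_cast
        rintro ⟨-, e, -⟩
        linarith
      all_goals
        rw [PinballComponent.parabola_obstructs_iff]
        push_cast
        rintro ⟨-, -, e⟩
        nlinarith
    · norm_num [planeDot, PinballComponent.normal]
    · ext <;> norm_num [reflectVelocity, planeDot, PinballComponent.normal]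
    all_goals linarith
  have leg3 : Travels pushZero pathBox ((s - 1) / 2, 3 + (s ^ 2 + 2 * s) / 4) (0, -1)
      (3 + (s ^ 2 + 2 * s) / 4 - (3 - s) / 2 + (1 / 2 + (3 - s) / 2)) (s / 2, 0) (0, -1) := by
    refine .bounce_to (.wall (-1 / 2, 3 / 2) (0, 1)) (q := ((s - 1) / 2, (3 - s) / 2))
      convex_pathBox (mk_mem_pathBox ?_ ?_ ?_ ?_) (mk_mem_pathBox ?_ ?_ ?_ ?_) (by linarith)
      (by ext <;> simp) (fun z hz => ?_) (by simp [pushZero]) ?_ ?_ ?_ ?_ leg4 rfl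
    rotate_right 5
    · obtain ⟨e0, e1, e2⟩ := mem_openSegment_vertical (by linarith) hz
      refine forall_mem_pushZero_not_obstructs ?_ ?_ ?_ ?_ <;> rw [e0] <;> intro _ _ e <;> nlinarith
    · rw [PinballComponent.wall_obstructs_iff (by norm_num)]
      push_cast
      refine ⟨?_, ?_, ?_⟩ <;> linarith
    · simp only [pushZero, List.forall_mem_cons]
      refine ⟨.inr ?_, .inr ?_, .inl trivial, .inr ?_, by simp⟩
      rotate_right
      · rw [PinballComponent.wall_obstructs_iff (by norm_num)]
        push_cast
        rintro ⟨e, -, -⟩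
        linarith
      all_goals
        rw [PinballComponent.parabola_obstructs_iff]
        push_cast
        rintro ⟨-, -, e⟩
        nlinarith
    · norm_num [planeDot, PinballComponent.normal]
    · ext <;> norm_num [reflectVelocity, planeDot, PinballComponent.normal]
    all_goals linarith
  have hm : 1 + (s + 1) ^ 2 ≠ 0 := by positivity
  -- corresponding points of two confocal parabolas have parallel tangents
  have hn : (PinballComponent.parabola 1 2 (15 / 4) (-1 / 2) 0).normal
      ((s - 1) / 2, 3 + (s ^ 2 + 2 * s) / 4) = (s + 1, -1) := by
    ext <;> simp [PinballComponent.normal]; ring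
  -- the chord has length `(1 - λ) (1 + m ^ 2) / (4 * a)`, where `m` is the slope of the tangent,
  -- here with `a = 1 / 2`, `λ = 1 / 2` and `m = s + 1`
  have leg2 := Travels.bounce_to (M := pushZero) (R := pathBox) (.parabola 1 2 (15 / 4) (-1 / 2) 0)
    (p := (s, s ^ 2 / 2 + s + 3)) (τ := (1 + (s + 1) ^ 2) / 4)
    (v := (-2 * (s + 1) / (1 + (s + 1) ^ 2), (1 - (s + 1) ^ 2) / (1 + (s + 1) ^ 2)))
    convex_pathBox (mk_mem_pathBox (by linarith) (by linarith) (by linarith) (by linarith))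
    (mk_mem_pathBox (by linarith) (by linarith) (by linarith) (by linarith)) (by positivity)
    (by ext <;> simp <;> field_simp <;> ring) (fun z hz => by
      obtain ⟨c, d, hc, hd, hcd, rfl⟩ := hz
      obtain rfl : d = 1 - c := by linarith
      refine forall_mem_pushZero_not_obstructs ?_ ?_ ?_ ?_ <;> simp <;> intro _ _ e
      -- at the point `c • p + (1 - c) • q` of the chord from `p` to `q`, the equation of a parabola
      -- would make a product of positive factors vanish
      · have : (1 - c) / 2 * ((1 + c) / 2 * (s + 1) ^ 2 + 1) = 0 := by linarith
        have : 0 < (1 - c) / 2 * ((1 + c) / 2 * (s + 1) ^ 2 + 1) := by positivity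
        linarith
      · have : c / 2 * ((1 + c) / 2 * (s + 1) ^ 2 + 1 / 2) = 0 := by linarith
        have : 0 < c / 2 * ((1 + c) / 2 * (s + 1) ^ 2 + 1 / 2) := by positivity
        linarith
      · nlinarith [mul_pos hc hs', mul_pos hd hs', mul_pos hc h0, mul_pos hd h0]
      · nlinarith [mul_pos hc hs', mul_pos hd hs', mul_pos hc h0, mul_pos hd h0])
    (by simp [pushZero])
    (by
      rw [PinballComponent.parabola_obstructs_iff]
      push_cast
      refine ⟨?_, ?_, ?_⟩ <;> linarith)
    (by
      simp only [pushZero, List.forall_mem_cons]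
      refine ⟨.inr ?_, .inl trivial, .inr ?_, .inr ?_, by simp⟩
      · rw [PinballComponent.parabola_obstructs_iff]
        push_cast
        rintro ⟨e, -, -⟩
        linarith
      all_goals
        rw [PinballComponent.wall_obstructs_iff (by norm_num)]
        push_cast
        rintro ⟨e, e', e''⟩
        linarith)
    (by
      rw [hn]
      exact planeDot_of_reflectVelocity_down_ne_zero (s + 1))
    (by
      rw [hn]
      exact reflectVelocity_to_down (s + 1)) leg3 rfl
  refine Travels.bounce_to (M := pushZero) (R := pathBox) (.parabola (1 / 2) 1 3 0 1)
    (q := (s, s ^ 2 / 2 + s + 3)) (τ := 3 - s - s ^ 2 / 2) convex_pathBox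
    (mk_mem_pathBox ?_ ?_ ?_ ?_) (mk_mem_pathBox ?_ ?_ ?_ ?_) (by linarith)
      (by ext <;> simp; ring) (fun z hz => ?_) (by simp [pushZero]) ?_ ?_ ?_ ?_ leg2 ?_
  rotate_right 6
  · obtain ⟨e0, e1, e2⟩ := mem_openSegment_vertical (by linarith) hz
    refine forall_mem_pushZero_not_obstructs ?_ ?_ ?_ ?_ <;> rw [e0] <;> intro _ _ e <;> nlinarith
  · rw [PinballComponent.parabola_obstructs_iff]
    push_cast
    refine ⟨?_, ?_, ?_⟩ <;> linarith
  · simp only [pushZero, List.forall_mem_cons]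
    refine ⟨.inl trivial, .inr ?_, .inr ?_, .inr ?_, by simp⟩
    · rw [PinballComponent.parabola_obstructs_iff]
      push_cast
      rintro ⟨-, e, -⟩
      linarith
    all_goals
      rw [PinballComponent.wall_obstructs_iff (by norm_num)]
      push_cast
      rintro ⟨e, e', e''⟩
      linarith
  · simp [planeDot, PinballComponent.normal]
  · convert reflectVelocity_down (s + 1) using 2
    simp [PinballComponent.normal]
  · ring
  all_goals linarith

/-! ### Pop -/

/-- The left half of the pop gadget, `s ↦ 2 * s - 1` for `s < 1 / 2`: two parabolas with common
focus `(1, 1)` double the distance to the line `x = 1`. -/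
def popLeft : List PinballComponent :=
  [.parabola (-1 / 2) 1 1 0 (1 / 2), .parabola (-1 / 4) (1 / 2) (7 / 4) (-1) 0]

/-- The pop gadget: offsets on either side of `1 / 2` are treated by one of two mirror images. -/
def popGadget : List PinballComponent := popLeft ++ popLeft.map PinballComponent.mirror

theorem fitsPathBox_popLeft : FitsPathBox popLeft := by
  simp only [FitsPathBox, popLeft, List.forall_mem_cons]
  refine ⟨fun p hp => ?_, fun p hp => ?_, by simp⟩
  all_goals
    obtain ⟨e0, e1, e2⟩ := PinballComponent.mem_parabola_iff.1 hp
    push_cast at e0 e1 e2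
    refine ⟨?_, ?_, ?_, ?_⟩ <;> nlinarith

theorem fitsPathBox_popGadget : FitsPathBox popGadget :=
  fitsPathBox_popLeft.append fitsPathBox_popLeft.mirror

theorem mem_map_mirror_popGadget (K : PinballComponent) :
    K ∈ popGadget.map PinballComponent.mirror ↔ K ∈ popGadget := by
  have : PinballComponent.mirror ∘ PinballComponent.mirror = id :=
    funext PinballComponent.mirror_mirror
  simp only [popGadget, List.map_append, List.map_map, this, List.map_id, List.mem_append]
  exact or_comm

theorem forall_mem_popGadget_not_obstructs {z v : ℝ × ℝ} (hz : z.1 < 1 / 2)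
    (h1 : 0 ≤ z.1 → z.2 ≠ -z.1 ^ 2 / 2 + z.1 + 1)
    (h2 : -1 ≤ z.1 → z.1 ≤ 0 → z.2 ≠ -z.1 ^ 2 / 4 + z.1 / 2 + 7 / 4) :
    ∀ K ∈ popGadget, ¬ K.Obstructs z v := by
  simp only [popGadget, popLeft, List.map_cons, PinballComponent.mirror, List.map_nil,
    List.cons_append, List.nil_append, List.forall_mem_cons,
    PinballComponent.parabola_obstructs_iff]
  push_cast
  refine ⟨?_, ?_, ?_, ?_, by simp⟩ <;> rintro ⟨e0, e1, e2⟩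
  · exact h1 e0 (by linarith)
  · exact h2 e0 e1 (by linarith)
  · linarith
  · linarith

theorem popGadget_unitDelivers {s : ℝ} (h0 : 0 < s) (h1 : s < 1 / 2) :
    UnitDelivers popGadget s (2 * s - 1) 7 := by
  have hs : s ^ 2 < s / 2 := by nlinarith
  have hs' : 0 < s ^ 2 := by positivity
  have leg3 : Travels popGadget pathBox (2 * s - 1, 1 + 2 * s - s ^ 2) (0, -1) (1 + 2 * s - s ^ 2)
      (2 * s - 1, 0) (0, -1) := by
    refine .fly_to convex_pathBox (mk_mem_pathBox ?_ ?_ ?_ ?_) (mk_mem_pathBox ?_ ?_ ?_ ?_) ?_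
      (by ext <;> simp) (fun z hz => ?_) ?_
    rotate_right 2
    · obtain ⟨e0, e1, e2⟩ := mem_openSegment_vertical (by linarith) hz
      refine forall_mem_popGadget_not_obstructs (by linarith) ?_ ?_ <;> rw [e0] <;> intros <;>
        nlinarith
    · refine forall_mem_popGadget_not_obstructs (by dsimp only; linarith) ?_ ?_ <;> dsimp only
      · intro e
        linarith
      · intro _ _ e
        nlinarith
    all_goals linarith
  have hm : 1 + (1 - s) ^ 2 ≠ 0 := by positivity
  -- corresponding points of two confocal parabolas have parallel tangents
  have hn : (PinballComponent.parabola (-1 / 4) (1 / 2) (7 / 4) (-1) 0).normal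
      (2 * s - 1, 1 + 2 * s - s ^ 2) = (1 - s, -1) := by
    ext <;> simp [PinballComponent.normal]; ring
  -- the chord has length `(1 - λ) (1 + m ^ 2) / (4 * a)`, where `m` is the slope of the tangent,
  -- here with `a = -1 / 2`, `λ = 2` and `m = 1 - s`
  have leg2 := Travels.bounce_to (M := popGadget) (R := pathBox)
    (.parabola (-1 / 4) (1 / 2) (7 / 4) (-1) 0)
    (p := (s, 1 + s - s ^ 2 / 2)) (τ := (1 + (1 - s) ^ 2) / 2)
    (v := (-2 * (1 - s) / (1 + (1 - s) ^ 2), (1 - (1 - s) ^ 2) / (1 + (1 - s) ^ 2)))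
    convex_pathBox (mk_mem_pathBox (by linarith) (by linarith) (by linarith) (by linarith))
    (mk_mem_pathBox (by linarith) (by linarith) (by linarith) (by linarith)) (by positivity)
    (by ext <;> simp <;> field_simp <;> ring) (fun z hz => by
      obtain ⟨c, d, hc, hd, hcd, rfl⟩ := hz
      obtain rfl : d = 1 - c := by linarith
      refine forall_mem_popGadget_not_obstructs ?_ ?_ ?_ <;> simp
      · nlinarith
      -- at the point `c • p + (1 - c) • q` of the chord from `p` to `q`, the equation of a parabola
      -- would make a product of positive factors vanish
      · intro _ e
        have : (1 - c) / 2 * (1 + (1 + (1 - c)) * (1 - s) ^ 2) = 0 := by linarith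
        have : 0 < (1 - c) / 2 * (1 + (1 + (1 - c)) * (1 - s) ^ 2) := by positivity
        linarith
      · intro _ _ e
        have : c / 4 * (2 + (1 + (1 - c)) * (1 - s) ^ 2) = 0 := by linarith
        have : 0 < c / 4 * (2 + (1 + (1 - c)) * (1 - s) ^ 2) := by positivity
        linarith)
    (by simp [popGadget, popLeft])
    (by
      rw [PinballComponent.parabola_obstructs_iff]
      push_cast
      refine ⟨?_, ?_, ?_⟩ <;> linarith)
    (by
      simp only [popGadget, popLeft, List.map_cons, PinballComponent.mirror, List.map_nil,
        List.cons_append, List.nil_append, List.forall_mem_cons,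
        PinballComponent.parabola_obstructs_iff]
      push_cast
      refine ⟨.inr ?_, .inl trivial, .inr ?_, .inr ?_, by simp⟩ <;> rintro ⟨e0, e1, e2⟩ <;>
        linarith)
    (by
      rw [hn]
      exact planeDot_of_reflectVelocity_down_ne_zero (1 - s))
    (by
      rw [hn]
      exact reflectVelocity_to_down (1 - s)) leg3 rfl
  refine Travels.bounce_to (M := popGadget) (R := pathBox) (.parabola (-1 / 2) 1 1 0 (1 / 2))
    (q := (s, 1 + s - s ^ 2 / 2)) (τ := 5 - s + s ^ 2 / 2) convex_pathBox
    (mk_mem_pathBox ?_ ?_ ?_ ?_) (mk_mem_pathBox ?_ ?_ ?_ ?_) (by linarith)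
      (by ext <;> simp; ring) (fun z hz => ?_) (by simp [popGadget, popLeft]) ?_ ?_ ?_ ?_ leg2 ?_
  rotate_right 6
  · obtain ⟨e0, e1, e2⟩ := mem_openSegment_vertical (by linarith) hz
    refine forall_mem_popGadget_not_obstructs (by linarith) ?_ ?_ <;> rw [e0] <;> intros <;>
      linarith
  · rw [PinballComponent.parabola_obstructs_iff]
    push_cast
    refine ⟨?_, ?_, ?_⟩ <;> linarith
  · simp only [popGadget, popLeft, List.map_cons, PinballComponent.mirror, List.map_nil,
      List.cons_append, List.nil_append, List.forall_mem_cons,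
      PinballComponent.parabola_obstructs_iff]
    push_cast
    refine ⟨.inl trivial, .inr ?_, .inr ?_, .inr ?_, by simp⟩ <;> rintro ⟨e0, e1, e2⟩ <;> linarith
  · simp [planeDot, PinballComponent.normal]
  · have hn' : (PinballComponent.parabola (-1 / 2) 1 1 0 (1 / 2)).normal
        (s, 1 + s - s ^ 2 / 2) = (1 - s, -1) := by
      ext <;> simp [PinballComponent.normal]; ring
    rw [hn']
    exact reflectVelocity_down (1 - s)
  · ring
  all_goals linarith

/-! ### Rejoin -/

/-- The gadget that moves `[-1, 0]` and `[1, 2]` onto `[0, 1]`, by a pair of parallel diagonal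
walls for each of the two intervals. The lower wall above `[0, 1]` is a gate, which the ball that
comes from the higher one passes downwards. -/
def rejoinGadget : List PinballComponent :=
  [.wall (-1, 2) (0, 1), .gate (0, 2) (1, 1), .wall (1, 3) (2, 4), .wall (0, 3) (1, 4)]

theorem fitsPathBox_rejoinGadget : FitsPathBox rejoinGadget := by
  simp only [FitsPathBox, rejoinGadget, List.forall_mem_cons]
  refine ⟨fun p hp => ?_, fun p hp => ?_, fun p hp => ?_, fun p hp => ?_, by simp⟩
  · obtain ⟨e0, e1, e2⟩ := (PinballComponent.mem_wall_iff (by norm_num)).1 hp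
    push_cast at e0 e1 e2
    refine ⟨?_, ?_, ?_, ?_⟩ <;> linarith
  · obtain ⟨e0, e1, e2⟩ := (PinballComponent.mem_gate_iff (by norm_num)).1 hp
    push_cast at e0 e1 e2
    refine ⟨?_, ?_, ?_, ?_⟩ <;> linarith
  all_goals
    obtain ⟨e0, e1, e2⟩ := (PinballComponent.mem_wall_iff (by norm_num)).1 hp
    push_cast at e0 e1 e2
    refine ⟨?_, ?_, ?_, ?_⟩ <;> linarith

theorem forall_mem_rejoinGadget_or {P : PinballComponent → Prop} {z v : ℝ × ℝ}
    (h1 : P (.wall (-1, 2) (0, 1)) ∨ (z.1 ≤ 0 → z.2 ≠ 1 - z.1))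
    (h2 : P (.gate (0, 2) (1, 1)) ∨ (0 ≤ z.1 → z.1 ≤ 1 → z.2 = 2 - z.1 → v.1 + v.2 < 0))
    (h3 : P (.wall (1, 3) (2, 4)) ∨ (1 ≤ z.1 → z.2 ≠ z.1 + 2))
    (h4 : P (.wall (0, 3) (1, 4)) ∨ (0 ≤ z.1 → z.1 ≤ 1 → z.2 ≠ z.1 + 3)) :
    ∀ K ∈ rejoinGadget, P K ∨ ¬ K.Obstructs z v := by
  simp only [rejoinGadget, List.forall_mem_cons]
  refine ⟨h1.imp_right fun h => ?_, h2.imp_right fun h => ?_, h3.imp_right fun h => ?_,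
    h4.imp_right fun h => ?_, by simp⟩
  · rw [PinballComponent.wall_obstructs_iff (by norm_num)]
    push_cast
    rintro ⟨e0, e1, e2⟩
    exact h e1 (by linarith)
  · rw [PinballComponent.gate_obstructs_iff (by norm_num)]
    push_cast
    rintro ⟨⟨e0, e1, e2⟩, e3⟩
    have := h e0 e1 (by linarith)
    linarith
  · rw [PinballComponent.wall_obstructs_iff (by norm_num)]
    push_cast
    rintro ⟨e0, e1, e2⟩
    exact h e0 (by linarith)
  · rw [PinballComponent.wall_obstructs_iff (by norm_num)]
    push_cast
    rintro ⟨e0, e1, e2⟩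
    exact h e0 e1 (by linarith)

theorem forall_mem_rejoinGadget_not_obstructs {z v : ℝ × ℝ} (h1 : z.1 ≤ 0 → z.2 ≠ 1 - z.1)
    (h2 : 0 ≤ z.1 → z.1 ≤ 1 → z.2 = 2 - z.1 → v.1 + v.2 < 0) (h3 : 1 ≤ z.1 → z.2 ≠ z.1 + 2)
    (h4 : 0 ≤ z.1 → z.1 ≤ 1 → z.2 ≠ z.1 + 3) : ∀ K ∈ rejoinGadget, ¬ K.Obstructs z v :=
  fun K hK => (forall_mem_rejoinGadget_or (P := fun _ => False) (.inr h1) (.inr h2) (.inr h3)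
    (.inr h4) K hK).resolve_left id

theorem rejoinGadget_unitDelivers_left {s : ℝ} (h0 : 0 < s) (h1 : s < 1) :
    UnitDelivers rejoinGadget (s - 1) s 7 := by
  have leg3 : Travels rejoinGadget pathBox (s, 2 - s) (0, -1) (2 - s) (s, 0) (0, -1) := by
    refine .fly_to convex_pathBox (mk_mem_pathBox ?_ ?_ ?_ ?_) (mk_mem_pathBox ?_ ?_ ?_ ?_) ?_
      (by ext <;> simp) (fun z hz => ?_) ?_
    rotate_right 2
    · obtain ⟨e0, e1, e2⟩ := mem_openSegment_vertical (by linarith) hz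
      refine forall_mem_rejoinGadget_not_obstructs ?_ ?_ ?_ ?_ <;> rw [e0] <;> intros <;> linarith
    · refine forall_mem_rejoinGadget_not_obstructs ?_ ?_ ?_ ?_ <;> dsimp only <;> intros <;>
        linarith
    all_goals linarith
  have leg2 : Travels rejoinGadget pathBox (s - 1, 2 - s) (1, 0) (1 + (2 - s)) (s, 0) (0, -1) := by
    refine .bounce_to (.gate (0, 2) (1, 1)) (q := (s, 2 - s)) convex_pathBox
      (mk_mem_pathBox ?_ ?_ ?_ ?_) (mk_mem_pathBox ?_ ?_ ?_ ?_) one_pos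
      (by ext <;> simp) (fun z hz => ?_) (by simp [rejoinGadget]) ?_ ?_ ?_ ?_ leg3 rfl
    rotate_right 5
    · obtain ⟨e0, e1, e2⟩ := mem_openSegment_right (by linarith) hz
      refine forall_mem_rejoinGadget_not_obstructs ?_ ?_ ?_ ?_ <;> rw [e0] <;> intros <;> linarith
    · rw [PinballComponent.gate_obstructs_iff (by norm_num)]
      push_cast
      refine ⟨⟨?_, ?_, ?_⟩, ?_⟩ <;> linarith
    · refine forall_mem_rejoinGadget_or (.inr ?_) (.inl rfl) (.inr ?_) (.inr ?_) <;> dsimp only <;>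
        intros <;> linarith
    · norm_num [planeDot, PinballComponent.normal]
    · ext <;> norm_num [reflectVelocity, planeDot, PinballComponent.normal]
    all_goals linarith
  refine Travels.bounce_to (.wall (-1, 2) (0, 1)) (q := (s - 1, 2 - s)) (τ := 4 + s) convex_pathBox
    (mk_mem_pathBox ?_ ?_ ?_ ?_) (mk_mem_pathBox ?_ ?_ ?_ ?_) ?_
    (by ext <;> simp; ring) (fun z hz => ?_) (by simp [rejoinGadget]) ?_ ?_ ?_ ?_ leg2 ?_
  rotate_right 6
  · obtain ⟨e0, e1, e2⟩ := mem_openSegment_vertical (by linarith) hz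
    refine forall_mem_rejoinGadget_not_obstructs ?_ ?_ ?_ ?_ <;> rw [e0] <;> intros <;> linarith
  · rw [PinballComponent.wall_obstructs_iff (by norm_num)]
    push_cast
    refine ⟨?_, ?_, ?_⟩ <;> linarith
  · refine forall_mem_rejoinGadget_or (.inl rfl) (.inr ?_) (.inr ?_) (.inr ?_) <;> dsimp only <;>
      intros <;> linarith
  · norm_num [planeDot, PinballComponent.normal]
  · ext <;> norm_num [reflectVelocity, planeDot, PinballComponent.normal]
  all_goals linarith

/-- The last leg passes the gate: there the velocity `(0, -1)` and the normal `(-1, -1)` have a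
positive scalar product. -/
theorem rejoinGadget_unitDelivers_right {s : ℝ} (h0 : 0 < s) (h1 : s < 1) :
    UnitDelivers rejoinGadget (1 + s) s 7 := by
  have leg3 : Travels rejoinGadget pathBox (s, 3 + s) (0, -1) (3 + s) (s, 0) (0, -1) := by
    refine .fly_to convex_pathBox (mk_mem_pathBox ?_ ?_ ?_ ?_) (mk_mem_pathBox ?_ ?_ ?_ ?_) ?_
      (by ext <;> simp) (fun z hz => ?_) ?_
    rotate_right 2
    · obtain ⟨e0, e1, e2⟩ := mem_openSegment_vertical (by linarith) hz
      refine forall_mem_rejoinGadget_not_obstructs ?_ ?_ ?_ ?_ <;> rw [e0] <;> intros <;> linarith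
    · refine forall_mem_rejoinGadget_not_obstructs ?_ ?_ ?_ ?_ <;> dsimp only <;> intros <;>
        linarith
    all_goals linarith
  have leg2 : Travels rejoinGadget pathBox (1 + s, 3 + s) (-1, 0) (1 + (3 + s)) (s, 0)
      (0, -1) := by
    refine .bounce_to (.wall (0, 3) (1, 4)) (q := (s, 3 + s)) convex_pathBox
      (mk_mem_pathBox ?_ ?_ ?_ ?_) (mk_mem_pathBox ?_ ?_ ?_ ?_) one_pos
      (by ext <;> simp) (fun z hz => ?_) (by simp [rejoinGadget]) ?_ ?_ ?_ ?_ leg3 rfl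
    rotate_right 5
    · obtain ⟨e0, e1, e2⟩ := mem_openSegment_left (by linarith) hz
      refine forall_mem_rejoinGadget_not_obstructs ?_ ?_ ?_ ?_ <;> rw [e0] <;> intros <;> linarith
    · rw [PinballComponent.wall_obstructs_iff (by norm_num)]
      push_cast
      refine ⟨?_, ?_, ?_⟩ <;> linarith
    · refine forall_mem_rejoinGadget_or (.inr ?_) (.inr ?_) (.inr ?_) (.inl rfl) <;> dsimp only <;>
        intros <;> linarith
    · norm_num [planeDot, PinballComponent.normal]
    · ext <;> norm_num [reflectVelocity, planeDot, PinballComponent.normal]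
    all_goals linarith
  refine Travels.bounce_to (.wall (1, 3) (2, 4)) (q := (1 + s, 3 + s)) (τ := 3 - s) convex_pathBox
    (mk_mem_pathBox ?_ ?_ ?_ ?_) (mk_mem_pathBox ?_ ?_ ?_ ?_) ?_
    (by ext <;> simp; ring) (fun z hz => ?_) (by simp [rejoinGadget]) ?_ ?_ ?_ ?_ leg2 ?_
  rotate_right 6
  · obtain ⟨e0, e1, e2⟩ := mem_openSegment_vertical (by linarith) hz
    refine forall_mem_rejoinGadget_not_obstructs ?_ ?_ ?_ ?_ <;> rw [e0] <;> intros <;> linarith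
  · rw [PinballComponent.wall_obstructs_iff (by norm_num)]
    push_cast
    refine ⟨?_, ?_, ?_⟩ <;> linarith
  · refine forall_mem_rejoinGadget_or (.inr ?_) (.inr ?_) (.inl rfl) (.inr ?_) <;> dsimp only <;>
      intros <;> linarith
  · norm_num [planeDot, PinballComponent.normal]
  · ext <;> norm_num [reflectVelocity, planeDot, PinballComponent.normal]
  all_goals linarith

/-! ### Offsets and the stack -/

/-- The exits of the pop gadget: `-1` for a popped `0` and `1` for a popped `1`. -/
def popExit (b : Bool) : ℚ := if b then 1 else -1

/-- The push gadgets; since `(s + 1) / 2 = 1 - (1 - s) / 2`, pushing `1` is the mirror image of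
pushing `0`. -/
def pushGadget (b : Bool) : List PinballComponent :=
  if b then pushZero.map PinballComponent.mirror else pushZero

theorem pushGadget_delivers (b : Bool) {s : ℝ} (h0 : 0 < s) (h1 : s < 1) :
    Delivers 2 6 (pushGadget b) s ((s + bitVal b) / 2) 7 := by
  cases b with
  | false => simpa [pushGadget, bitVal] using (pushZero_unitDelivers h0 h1).delivers
  | true =>
    have h := (pushZero_unitDelivers (sub_pos.2 h1) (by linarith : 1 - s < 1)).mirror.delivers
    rw [sub_sub_cancel, show 1 - (1 - s) / 2 = (s + 1) / 2 by ring] at h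
    simpa [pushGadget, bitVal] using h

theorem popGadget_delivers (b : Bool) {s : ℝ} (h0 : 0 < s) (h1 : s < 1) (h2 : s ≠ 1 / 2)
    (hb : (⌊2 * s⌋ : ℝ) = bitVal b) :
    Delivers 2 6 popGadget s ((popExit b : ℝ) + (2 * s - (⌊2 * s⌋ : ℝ))) 7 := by
  have hle := Int.floor_le (2 * s)
  have hlt := Int.lt_floor_add_one (2 * s)
  rw [hb] at hle hlt ⊢
  cases b with
  | false =>
    simp only [bitVal, Bool.false_eq_true, if_false] at hlt
    convert (popGadget_unitDelivers h0 (by linarith)).delivers using 1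
    simp [popExit, bitVal]
    ring
  | true =>
    simp only [bitVal, if_true] at hle
    have hs : 1 / 2 < s := lt_of_le_of_ne (by linarith) h2.symm
    have h : UnitDelivers _ _ _ _ :=
      (popGadget_unitDelivers (sub_pos.2 h1) (by linarith : 1 - s < 1 / 2)).mirror.mono
        mem_map_mirror_popGadget subset_rfl
    rw [sub_sub_cancel] at h
    convert h.delivers using 1
    simp [popExit, bitVal]
    ring

theorem rejoinGadget_delivers (b : Bool) {s : ℝ} (h0 : 0 < s) (h1 : s < 1) :
    Delivers 2 6 rejoinGadget ((popExit b : ℝ) + s) s 7 := by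
  cases b with
  | false =>
    convert (rejoinGadget_unitDelivers_left h0 h1).delivers using 1
    simp [popExit]
    ring
  | true => simpa [popExit] using (rejoinGadget_unitDelivers_right h0 h1).delivers

theorem stackOffset_mem_Ioo (l : List Bool) : 0 < stackOffset l ∧ stackOffset l < 1 := by
  induction l with
  | nil => norm_num [stackOffset]
  | cons b l ih =>
    obtain ⟨h0, h1⟩ := ih
    cases b <;> simp only [stackOffset, bitVal, if_true, Bool.false_eq_true, if_false] <;>
      constructor <;> linarith

theorem stackOffset_ne_half (l : List Bool) : stackOffset l ≠ 1 / 2 := by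
  cases l with
  | nil => norm_num [stackOffset]
  | cons b l =>
    obtain ⟨h0, h1⟩ := stackOffset_mem_Ioo l
    intro e
    cases b <;> simp only [stackOffset, bitVal, if_true, Bool.false_eq_true, if_false] at e <;>
      linarith

theorem floor_two_mul_stackOffset_cons (b : Bool) (l : List Bool) :
    (⌊2 * stackOffset (b :: l)⌋ : ℝ) = bitVal b := by
  obtain ⟨h0, h1⟩ := stackOffset_mem_Ioo l
  have h : ⌊2 * stackOffset (b :: l)⌋ = if b then 1 else 0 := by
    rw [Int.floor_eq_iff]
    cases b <;> simp only [stackOffset, bitVal, if_true, Bool.false_eq_true, if_false] <;>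
      push_cast <;> constructor <;> linarith
  rw [h]
  cases b <;> simp [bitVal]

theorem mainTheorem4 :
    -- focus property of a parabolic wall, with the travel time to the focus
    (∀ (a b x₀ x₁ : ℚ) (ℓ h σ : ℝ), 0 < a → (x₀ : ℝ) ≤ ℓ → ℓ ≤ (x₁ : ℝ) →
      (a : ℝ) * ℓ ^ 2 + (b : ℝ) < h → 0 < σ →
      ∃ v : ℝ × ℝ, Travels [PinballComponent.parabola a 0 b x₀ x₁] Set.univ (ℓ, h) (0, -σ)
        ((h - (b : ℝ) + 1 / (4 * (a : ℝ))) / σ) (0, 1 / (4 * (a : ℝ)) + (b : ℝ)) v) ∧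
    -- the stack gadgets
    (∃ (w H : ℚ) (exit : Bool → ℚ) (L L' : ℝ)
        (push : Bool → List PinballComponent) (pop rejoin : List PinballComponent),
      (∀ b, FitsBox w H (push b)) ∧ FitsBox w H pop ∧ FitsBox w H rejoin ∧
      -- the exit for a popped `0` is to the left of, and disjoint from, the one for a popped `1`
      exit false + 1 < exit true ∧
      -- push of a bit `b`
      (∀ (b : Bool) (s : ℝ), 0 < s → s < 1 →
        Delivers w H (push b) s ((s + bitVal b) / 2) L) ∧
      -- pop
      (∀ (b : Bool) (s : ℝ), 0 < s → s < 1 → s ≠ 1 / 2 → (⌊2 * s⌋ : ℝ) = bitVal b →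
        Delivers w H pop s ((exit b : ℝ) + (2 * s - (⌊2 * s⌋ : ℝ))) L) ∧
      -- the two exit intervals of pop can be superposed again
      (∀ (b : Bool) (s : ℝ), 0 < s → s < 1 →
        Delivers w H rejoin ((exit b : ℝ) + s) s L') ∧
      -- hence the gadgets act as a stack on the offsets that represent stack contents
      (∀ l : List Bool, 0 < stackOffset l ∧ stackOffset l < 1 ∧ stackOffset l ≠ 1 / 2) ∧
      (∀ (b : Bool) (l : List Bool),
        Delivers w H (push b) (stackOffset l) (stackOffset (b :: l)) L ∧
        Delivers w H pop (stackOffset (b :: l)) ((exit b : ℝ) + stackOffset l) L)) := by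
  refine ⟨fun a b x₀ x₁ ℓ h σ ha h0 h1 hh hσ => ?_, 2, 6, popExit, 7, 7, pushGadget, popGadget,
    rejoinGadget, fun b => ?_, fitsPathBox_popGadget.fitsBox, fitsPathBox_rejoinGadget.fitsBox,
    by norm_num [popExit], fun b s h0 h1 => pushGadget_delivers b h0 h1,
    fun b s h0 h1 h2 hb => popGadget_delivers b h0 h1 h2 hb,
    fun b s h0 h1 => rejoinGadget_delivers b h0 h1,
    fun l => ⟨(stackOffset_mem_Ioo l).1, (stackOffset_mem_Ioo l).2, stackOffset_ne_half l⟩,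
    fun b l => ⟨?_, ?_⟩⟩
  · obtain ⟨v, hv⟩ := travels_to_focus ha h0 h1 hh
    exact ⟨σ • v, by simpa using hv.scale_speed hσ⟩
  · cases b
    · exact fitsPathBox_pushZero.fitsBox
    · exact fitsPathBox_pushZero.mirror.fitsBox
  · exact pushGadget_delivers b (stackOffset_mem_Ioo l).1 (stackOffset_mem_Ioo l).2
  · obtain ⟨h0, h1⟩ := stackOffset_mem_Ioo (b :: l)
    have hb := floor_two_mul_stackOffset_cons b l
    have h := popGadget_delivers b h0 h1 (stackOffset_ne_half _) hb
    rwa [hb, show 2 * stackOffset (b :: l) - bitVal b = stackOffset l by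
      simp only [stackOffset]; ring] at h
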